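/- Consider the uplink of a cell-free network with $K\ge 1$ single-antenna UEs and $L$ APs with $N$ antennas each. On a probability space let $\mathbf h_{il}\in\mathbb C^N$ (channel of UE $i$ to AP $l$) and $\mathbf v_{kl}\in\mathbb C^N$ (local combiner for UE $k$ at AP $l$) be random vectors, let $\mathcal M_k\subseteq\{1,\dots,L\}$ be the set of APs serving UE $k$, let $\sigma^2>0$ be the noise variance and $\rho_u>0$ the maximum power. Put $$\mathbf g_{ki}=\big(\mathbf v_{kl}^{H}\mathbf h_{il}\big)_{l\in\mathcal M_k},\qquad \mathbf F_k=\mathrm{diag}\big(\sigma^2\,\mathbb E\{\|\mathbf v_{kl}\|^2\}\big)_{l\in\mathcal M_k},$$ $$\mathbf C_k(\eta)=\sum_{i=1}^K\eta_i\,\mathbb E\{\mathbf g_{ki}\mathbf g_{ki}^H\}-\eta_k\,\mathbb E\{\mathbf g_{kk}\}\mathbb E\{\mathbf g_{kk}\}^H+\mathbf F_k .$$ Assume that for all $k,i$ and all $l\in\mathcal M_k$ the variables $\|\mathbf v_{kl}\|$ and $\mathbf v_{kl}^H\mathbf h_{il}$ have finite second moments, that $\mathbf v_{kl}$ is not almost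 surely zero, and that $\mathbb E\{\mathbf g_{kk}\}\neq\mathbf 0$. The SINR of UE $k$ with powers $\eta$ and LSFD (large-scale fading decoding) vector $\mathbf a_k\in\mathbb C^{|\mathcal M_k|}$ is $$\mathrm{SINR}_k(\eta,\mathbf a_k)=\frac{\eta_k|\mathbf a_k^H\mathbb E\{\mathbf g_{kk}\}|^2}{\mathbf a_k^H\mathbf C_k(\eta)\mathbf a_k}$$ (read as $0$ for $\mathbf a_k=\mathbf 0$); with the optimal LSFD vector $\mathbf a_k^{\rm opt}(\eta)=\mathbf C_k(\eta)^{-1}\mathbb E\{\mathbf g_{kk}\}$ it equals $\mathrm{SINR}^{\rm opt}_k(\eta)=\eta_k\,\mathbb E\{\mathbf g_{kk}\}^H\mathbf C_k(\eta)^{-1}\mathbb E\{\mathbf g_{kk}\}$. From initial powers $\eta^{(0)}$ the fixed-point algorithm computes, for $j=1,2,\dots$, $$\tilde\eta_k^{(j)}=\frac{1}{\mathbb E\{\mathbf g_{kk}\}^H\,\mathbf C_k(\eta^{(j-1)})^{-1}\,\mathbb E\{\mathbf g_{kk}\}},\qquad \eta_k^{(j)}=\frac{\rho_u}{\max_i\tilde\eta_i^{(j)}}\,\tilde\eta_k^{(j)},\qquad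 k=1,\dots,K.$$ Then there is a power vector $\eta^\star$ that is a global optimum of $$\max_{\eta}\ \min_k\ \mathrm{SINR}_k^{\rm opt}(\eta)\quad\text{subject to}\quad 0\le\eta_k\le\rho_u,\ k=1,\dots,K,$$ such that $(\eta^\star,(\mathbf a_k^{\rm opt}(\eta^\star))_k)$ maximizes $\min_k\mathrm{SINR}_k(\eta,\mathbf a_k)$ jointly over all powers with $0\le\eta_k\le\rho_u$ and all LSFD vectors, and such that $\eta^{(j)}\to\eta^\star$ as $j\to\infty$ for every choice of initial powers with $\eta_k^{(0)}>0$ for all $k$. -/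

import Mathlib

open MeasureTheory Filter Topology
open scoped Matrix

noncomputable section

/-- Uplink of a user-centric cell-free network with `K` single-antenna UEs and `L` APs with `N`
antennas each. The channels and the local combiners are random vectors on `Ω`; no particular
distribution is imposed (correlated Rayleigh fading, with combiners computed from local channel
estimates, is a special case). -/
structure CellFree (K L N : ℕ) (Ω : Type*) where
  /-- `h k l` is the channel between UE `k` and AP `l`. -/
  h : Fin K → Fin L → Ω → EuclideanSpace ℂ (Fin N)
  /-- `v k l` is the local receive combiner for UE `k` at AP `l` (used only if `l ∈ M k`). -/
  v : Fin K → Fin L → Ω → EuclideanSpace ℂ (Fin N)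
  /-- `M k` is the set of APs that serve UE `k`. -/
  M : Fin K → Finset (Fin L)
  /-- `σ ^ 2` is the receiver noise variance. -/
  σ : ℝ

namespace CellFree

variable {K L N : ℕ} {Ω : Type*} [MeasurableSpace Ω]

/-- The receive-combined channel `g_ki`, with entries `v_kl^H h_il` for `l ∈ M k`
(the inner product is conjugate-linear in its first argument). -/
def g (S : CellFree K L N Ω) (k i : Fin K) (ω : Ω) : S.M k → ℂ :=
  fun l => inner ℂ (S.v k l ω) (S.h i l ω)

/-- `E{g_kk}`. -/
def meanG (S : CellFree K L N Ω) (P : Measure Ω) (k : Fin K) : S.M k → ℂ :=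
  fun l => ∫ ω, S.g k k ω l ∂P

/-- `E{g_ki g_ki^H}`. -/
def corrG (S : CellFree K L N Ω) (P : Measure Ω) (k i : Fin K) : Matrix (S.M k) (S.M k) ℂ :=
  Matrix.of fun l m => ∫ ω, S.g k i ω l * star (S.g k i ω m) ∂P

/-- The effective noise matrix `F_k = diag(σ² E‖v_kl‖² : l ∈ M k)`. -/
def noiseMat (S : CellFree K L N Ω) (P : Measure Ω) (k : Fin K) : Matrix (S.M k) (S.M k) ℂ :=
  Matrix.diagonal fun l => ((S.σ ^ 2 * ∫ ω, ‖S.v k l ω‖ ^ 2 ∂P : ℝ) : ℂ)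

/-- `C_k(η) = ∑ i, η_i E{g_ki g_ki^H} - η_k E{g_kk} E{g_kk}^H + F_k`. -/
def C (S : CellFree K L N Ω) (P : Measure Ω) (η : Fin K → ℝ) (k : Fin K) :
    Matrix (S.M k) (S.M k) ℂ :=
  (∑ i, (η i : ℂ) • S.corrG P k i)
    - (η k : ℂ) • Matrix.vecMulVec (S.meanG P k) (star (S.meanG P k))
    + S.noiseMat P k

/-- The effective SINR of UE `k` with powers `η` and LSFD weight vector `a`:
`η_k |a^H E{g_kk}|² / (a^H C_k(η) a)`. -/
def sinr (S : CellFree K L N Ω) (P : Measure Ω) (η : Fin K → ℝ) (k : Fin K)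
    (a : S.M k → ℂ) : ℝ :=
  η k * ‖star a ⬝ᵥ S.meanG P k‖ ^ 2 / (star a ⬝ᵥ (S.C P η k *ᵥ a)).re

/-- The optimal LSFD vector `C_k(η)⁻¹ E{g_kk}`. -/
def optLSFD (S : CellFree K L N Ω) (P : Measure Ω) (η : Fin K → ℝ) (k : Fin K) : S.M k → ℂ :=
  (S.C P η k)⁻¹ *ᵥ S.meanG P k

/-- The real number `E{g_kk}^H C_k(η)⁻¹ E{g_kk}`. -/
def gain (S : CellFree K L N Ω) (P : Measure Ω) (η : Fin K → ℝ) (k : Fin K) : ℝ :=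
  (star (S.meanG P k) ⬝ᵥ ((S.C P η k)⁻¹ *ᵥ S.meanG P k)).re

/-- The SINR with the optimal LSFD: `η_k E{g_kk}^H C_k(η)⁻¹ E{g_kk}`. -/
def sinrOpt (S : CellFree K L N Ω) (P : Measure Ω) (η : Fin K → ℝ) (k : Fin K) : ℝ :=
  η k * S.gain P η k

/-- The powers allowed by the per-UE constraints `0 ≤ η_k ≤ ρ`. -/
def feasible (K : ℕ) (ρ : ℝ) : Set (Fin K → ℝ) := {η | ∀ k, 0 ≤ η k ∧ η k ≤ ρ}

/-- `min_k x_k`. -/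
def minUE [NeZero K] (x : Fin K → ℝ) : ℝ := Finset.univ.inf' Finset.univ_nonempty x

/-- `max_k x_k`. -/
def maxUE [NeZero K] (x : Fin K → ℝ) : ℝ := Finset.univ.sup' Finset.univ_nonempty x

/-- The power update `η_k ← 1 / (E{g_kk}^H C_k(η)⁻¹ E{g_kk})`. -/
def update (S : CellFree K L N Ω) (P : Measure Ω) (η : Fin K → ℝ) : Fin K → ℝ :=
  fun k => 1 / S.gain P η k

/-- The rescaling `η_k ← (ρ / max_i η_i) η_k`. -/
def rescale [NeZero K] (ρ : ℝ) (η : Fin K → ℝ) : Fin K → ℝ :=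
  fun k => ρ / maxUE η * η k

/-- The powers after `j` iterations of the fixed-point algorithm started at `η₀`. -/
def iterate [NeZero K] (S : CellFree K L N Ω) (P : Measure Ω) (ρ : ℝ) (η₀ : Fin K → ℝ) :
    ℕ → Fin K → ℝ
  | 0 => η₀
  | j + 1 => rescale ρ (S.update P (S.iterate P ρ η₀ j))

end CellFree

end

/-! For fixed weights `a` with `a^H E{g_kk} = 1`, the quantity `a^H C_k(η) a` is affine in `η`, with
nonnegative coefficients and a positive constant term. By Cauchy–Schwarz, `update` is its minimum
over such `a`. A minimum of such affine maps is monotone, concave and positive at the origin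
(`isConcaveInterference_update`).

For any such map `T`, concavity towards `0` improves `a • x ≤ y` to `a ^ (1 - δ) * T x ≤ T y`, so
the rescaled iteration contracts Hilbert's projective metric by `1 - δ` (`hilbertClose_rescale`).
All normalized orbits therefore converge to one fixed point `z`.

The optimal SINR is `η k / T η k`. At `z` these ratios all coincide, and a feasible `x` cannot beat
them: with `μ = min x / z ≤ 1`, one has `T x ≥ T (μ • z) ≥ μ • T z`. Joint optimality over LSFD
vectors is Cauchy–Schwarz again (`sinr_le_sinrOpt`). -/

namespace CellFree

variable {K : ℕ} {T : (Fin K → ℝ) → Fin K → ℝ} {ρ : ℝ} {x y : Fin K → ℝ}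

/-- A monotone, concave self-map of the nonnegative orthant that is positive at the origin. -/
structure IsConcaveInterference (T : (Fin K → ℝ) → Fin K → ℝ) : Prop where
  mono : ∀ x y : Fin K → ℝ, 0 ≤ x → x ≤ y → ∀ k, T x k ≤ T y k
  concave : ∀ k, ConcaveOn ℝ (Set.Ici 0) fun x => T x k
  pos : ∀ k, 0 < T 0 k

/-! ### Concave interference maps -/

namespace IsConcaveInterference

lemma apply_pos (hT : IsConcaveInterference T) (hx : 0 ≤ x) (k : Fin K) : 0 < T x k :=
  (hT.pos k).trans_le (hT.mono 0 x le_rfl hx k)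

lemma le_smul (hT : IsConcaveInterference T) (hx : 0 ≤ x) {a : ℝ} (ha : 0 ≤ a) (ha1 : a ≤ 1)
    (k : Fin K) : a * T x k + (1 - a) * T 0 k ≤ T (a • x) k := by
  have := (hT.concave k).2 (Set.mem_Ici.2 hx) (Set.mem_Ici.2 (le_refl (0 : Fin K → ℝ))) ha
    (sub_nonneg.2 ha1) (by ring)
  simpa using this

/-- Since `T 0` is at least `δ * T x`, concavity on the segment from `0` to `x` gives the factor `(1
- δ) * a + δ`; weighted AM–GM bounds it below by a power of `a`, which is linear in `log a`. -/
lemma rpow_mul_le (hT : IsConcaveInterference T) {δ : ℝ} (hδ : 0 < δ) (hδ1 : δ ≤ 1)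
    (hδT : ∀ x, 0 ≤ x → (∀ k, x k ≤ ρ) → ∀ k, δ * T x k ≤ T 0 k)
    (hx : 0 ≤ x) (hxρ : ∀ k, x k ≤ ρ) {a : ℝ} (ha : 0 < a) (ha1 : a ≤ 1)
    (h : ∀ k, a * x k ≤ y k) (k : Fin K) : a ^ (1 - δ) * T x k ≤ T y k := by
  have h1 : a ^ (1 - δ) ≤ (1 - δ) * a + δ := by
    have := Real.geom_mean_le_arith_mean2_weighted (sub_nonneg.2 hδ1) hδ.le ha.le zero_le_one
      (by ring : 1 - δ + δ = 1)
    simpa using this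
  calc a ^ (1 - δ) * T x k ≤ ((1 - δ) * a + δ) * T x k :=
        mul_le_mul_of_nonneg_right h1 (hT.apply_pos hx k).le
    _ = a * T x k + (1 - a) * (δ * T x k) := by ring
    _ ≤ a * T x k + (1 - a) * T 0 k := by
        have := mul_le_mul_of_nonneg_left (hδT x hx hxρ k) (sub_nonneg.2 ha1)
        linarith
    _ ≤ T (a • x) k := hT.le_smul hx ha.le ha1 k
    _ ≤ T y k := hT.mono _ _ (smul_nonneg ha.le hx) h k

end IsConcaveInterference

/-! ### Normalized vectors and the projective metric -/

variable [NeZero K]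

lemma le_maxUE (x : Fin K → ℝ) (k : Fin K) : x k ≤ maxUE x :=
  Finset.le_sup' x (Finset.mem_univ k)

lemma minUE_le (x : Fin K → ℝ) (k : Fin K) : minUE x ≤ x k :=
  Finset.inf'_le x (Finset.mem_univ k)

lemma exists_eq_maxUE (x : Fin K → ℝ) : ∃ k, maxUE x = x k := by
  obtain ⟨k, -, hk⟩ := Finset.exists_mem_eq_sup' Finset.univ_nonempty x
  exact ⟨k, hk⟩

lemma exists_eq_minUE (x : Fin K → ℝ) : ∃ k, minUE x = x k := by
  obtain ⟨k, -, hk⟩ := Finset.exists_mem_eq_inf' Finset.univ_nonempty x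
  exact ⟨k, hk⟩

lemma continuous_maxUE : Continuous (maxUE : (Fin K → ℝ) → ℝ) := by
  unfold maxUE
  exact Continuous.finset_sup'_apply _ fun i _ => continuous_apply i

lemma minUE_mono {x y : Fin K → ℝ} (h : ∀ k, x k ≤ y k) : minUE x ≤ minUE y := by
  obtain ⟨k, hk⟩ := exists_eq_minUE y
  rw [hk]
  exact (minUE_le x k).trans (h k)

/-- Positive vectors whose largest entry is `ρ`. -/
def IsNormalized (ρ : ℝ) (x : Fin K → ℝ) : Prop := (∀ k, 0 < x k) ∧ maxUE x = ρ

/-- The Hilbert projective distance of `x` and `y` is at most `-log κ`. -/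
def HilbertClose (κ : ℝ) (x y : Fin K → ℝ) : Prop :=
  ∃ a b : ℝ, 0 < a ∧ 0 < b ∧ κ ≤ a * b ∧ (∀ k, a * x k ≤ y k) ∧ ∀ k, b * y k ≤ x k

lemma IsNormalized.le (hx : IsNormalized ρ x) (k : Fin K) : x k ≤ ρ :=
  hx.2 ▸ le_maxUE x k

lemma IsNormalized.factor_le_one (hx : IsNormalized ρ x) (hy : IsNormalized ρ y) {a : ℝ}
    (h : ∀ k, a * x k ≤ y k) : a ≤ 1 := by
  obtain ⟨k, hk⟩ := exists_eq_maxUE x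
  have h1 : a * x k ≤ x k := (h k).trans ((hy.le k).trans (by rw [← hk, hx.2]))
  by_contra! h2
  nlinarith [hx.1 k]

lemma HilbertClose.dist_le (hx : IsNormalized ρ x) (hy : IsNormalized ρ y) {κ : ℝ}
    (hκ : 0 < κ) (h : HilbertClose κ x y) : dist x y ≤ ρ * -Real.log κ := by
  obtain ⟨a, b, ha, hb, hab, h1, h2⟩ := h
  have ha1 := hx.factor_le_one hy h1
  have hb1 := hy.factor_le_one hx h2
  have hlog : 1 - κ ≤ -Real.log κ := by linarith [Real.log_le_sub_one_of_pos hκ]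
  have hρ : 0 < ρ := (hx.1 0).trans_le (hx.le 0)
  -- Each factor is at most `1`, so each is at least the product.
  have hκa : κ ≤ a := by nlinarith
  have hκb : κ ≤ b := by nlinarith
  have key : ∀ k, dist (x k) (y k) ≤ ρ * (1 - κ) := by
    intro k
    rw [Real.dist_eq, abs_le]
    have := hx.1 k
    have := hy.1 k
    have := hx.le k
    have := hy.le k
    have := h1 k
    have := h2 k
    constructor <;> nlinarith
  have hκ1 : κ ≤ 1 := hκa.trans ha1
  refine (dist_pi_le_iff (by nlinarith)).2 fun k => (key k).trans ?_
  gcongr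

lemma exists_hilbertClose (hx : IsNormalized ρ x) (hy : IsNormalized ρ y) :
    ∃ κ, 0 < κ ∧ HilbertClose κ x y := by
  have hρ : 0 < ρ := (hx.1 0).trans_le (hx.le 0)
  have pos : ∀ {z : Fin K → ℝ}, IsNormalized ρ z → 0 < minUE z := by
    intro z hz
    obtain ⟨k, hk⟩ := exists_eq_minUE z
    rw [hk]
    exact hz.1 k
  have bd : ∀ {z w : Fin K → ℝ}, IsNormalized ρ z → IsNormalized ρ w →
      ∀ k, minUE w / ρ * z k ≤ w k := by
    intro z w hz hw k
    refine le_trans ?_ (minUE_le w k)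
    rw [div_mul_eq_mul_div, div_le_iff₀ hρ]
    have := pos hw
    gcongr
    exact hz.le k
  have h1 := div_pos (pos hx) hρ
  have h2 := div_pos (pos hy) hρ
  exact ⟨_, mul_pos h2 h1, _, _, h2, h1, le_rfl, bd hx hy, bd hy hx⟩

/-! ### Contraction, fixed point and max-min optimality -/

namespace IsConcaveInterference

lemma maxUE_pos (hT : IsConcaveInterference T) (hx : 0 ≤ x) : 0 < maxUE (T x) :=
  (hT.apply_pos hx 0).trans_le (le_maxUE _ 0)

lemma isNormalized_rescale (hT : IsConcaveInterference T) (hρ : 0 < ρ) (hx : 0 ≤ x) :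
    IsNormalized ρ (rescale ρ (T x)) := by
  have hM := hT.maxUE_pos hx
  refine ⟨fun k => mul_pos (div_pos hρ hM) (hT.apply_pos hx k), le_antisymm ?_ ?_⟩
  · obtain ⟨k, hk⟩ := exists_eq_maxUE (rescale ρ (T x))
    rw [hk]
    calc ρ / maxUE (T x) * T x k ≤ ρ / maxUE (T x) * maxUE (T x) := by
          gcongr
          exact le_maxUE _ k
      _ = ρ := div_mul_cancel₀ _ hM.ne'
  · obtain ⟨k, hk⟩ := exists_eq_maxUE (T x)
    refine le_trans ?_ (le_maxUE _ k)
    rw [rescale, ← hk, div_mul_cancel₀ _ hM.ne']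

/-- By monotonicity `T (ρ, …, ρ)` dominates `T` on the whole box, so the ratio of the extreme values
`min T 0` and `max T (ρ, …, ρ)` serves as a uniform `δ`. -/
lemma exists_contraction_factor (hT : IsConcaveInterference T) (hρ : 0 < ρ) :
    ∃ δ, 0 < δ ∧ δ ≤ 1 ∧ ∀ x, 0 ≤ x → (∀ k, x k ≤ ρ) → ∀ k, δ * T x k ≤ T 0 k := by
  have h0 : (0 : Fin K → ℝ) ≤ fun _ => ρ := fun _ => hρ.le
  have hU := hT.maxUE_pos h0
  obtain ⟨m, hm⟩ := exists_eq_minUE (T 0)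
  have hmpos : 0 < minUE (T 0) := hm ▸ hT.pos m
  refine ⟨minUE (T 0) / maxUE (T fun _ => ρ), div_pos hmpos hU, ?_, ?_⟩
  · rw [div_le_one hU]
    exact (minUE_le _ 0).trans ((hT.mono _ _ le_rfl h0 0).trans (le_maxUE _ 0))
  · intro x hx hxρ k
    refine le_trans ?_ (minUE_le _ k)
    rw [div_mul_eq_mul_div, div_le_iff₀ hU]
    gcongr
    exact (hT.mono _ _ hx hxρ k).trans (le_maxUE _ k)

lemma hilbertClose_rescale (hT : IsConcaveInterference T) {δ : ℝ} (hδ : 0 < δ) (hδ1 : δ ≤ 1)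
    (hδT : ∀ x, 0 ≤ x → (∀ k, x k ≤ ρ) → ∀ k, δ * T x k ≤ T 0 k)
    (hx : IsNormalized ρ x) (hy : IsNormalized ρ y) {κ : ℝ} (hκ : 0 < κ)
    (h : HilbertClose κ x y) :
    HilbertClose (κ ^ (1 - δ)) (rescale ρ (T x)) (rescale ρ (T y)) := by
  obtain ⟨a, b, ha, hb, hab, h1, h2⟩ := h
  have hx0 : 0 ≤ x := fun k => (hx.1 k).le
  have hy0 : 0 ≤ y := fun k => (hy.1 k).le
  have hρ : 0 < ρ := (hx.1 0).trans_le (hx.le 0)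
  have hMx := hT.maxUE_pos hx0
  have hMy := hT.maxUE_pos hy0
  have step : ∀ {z w : Fin K → ℝ} {c : ℝ}, 0 < maxUE (T z) → 0 < maxUE (T w) →
      (∀ k, c * T z k ≤ T w k) → ∀ k, c * (maxUE (T z) / maxUE (T w)) * rescale ρ (T z) k
        ≤ rescale ρ (T w) k := by
    intro z w c hz hw hc k
    calc c * (maxUE (T z) / maxUE (T w)) * rescale ρ (T z) k
        = ρ / maxUE (T w) * (c * T z k) := by
          unfold rescale
          field_simp
      _ ≤ ρ / maxUE (T w) * T w k := by
          gcongr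
          exact hc k
  -- The two normalization ratios are reciprocal and cancel in the product: the projective distance
  -- ignores scaling.
  refine ⟨a ^ (1 - δ) * (maxUE (T x) / maxUE (T y)), b ^ (1 - δ) * (maxUE (T y) / maxUE (T x)),
    by positivity, by positivity, ?_, ?_, ?_⟩
  · calc κ ^ (1 - δ) ≤ (a * b) ^ (1 - δ) :=
          Real.rpow_le_rpow hκ.le hab (sub_nonneg.2 hδ1)
      _ = _ := by
          rw [Real.mul_rpow ha.le hb.le]
          field_simp
  · exact step hMx hMy (hT.rpow_mul_le hδ hδ1 hδT hx0 hx.le ha (hx.factor_le_one hy h1) h1)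
  · exact step hMy hMx (hT.rpow_mul_le hδ hδ1 hδT hy0 hy.le hb (hy.factor_le_one hx h2) h2)

lemma isNormalized_iterate (hT : IsConcaveInterference T) (hx : IsNormalized ρ x) (n : ℕ) :
    IsNormalized ρ ((fun x => rescale ρ (T x))^[n] x) := by
  have hρ : 0 < ρ := (hx.1 0).trans_le (hx.le 0)
  induction n with
  | zero => exact hx
  | succ n ih =>
    rw [Function.iterate_succ_apply']
    exact hT.isNormalized_rescale hρ fun k => (ih.1 k).le

/-- The normalized iteration forgets its starting point at a geometric rate. -/
lemma exists_geometric_rate (hT : IsConcaveInterference T) (hρ : 0 < ρ) :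
    ∃ r : ℝ, 0 ≤ r ∧ r < 1 ∧ ∀ x y, IsNormalized ρ x → IsNormalized ρ y → ∃ A : ℝ, ∀ n,
      dist ((fun x => rescale ρ (T x))^[n] x) ((fun x => rescale ρ (T x))^[n] y) ≤ A * r ^ n := by
  obtain ⟨δ, hδ, hδ1, hδT⟩ := hT.exists_contraction_factor hρ
  refine ⟨1 - δ, sub_nonneg.2 hδ1, by linarith, fun x y hx hy => ?_⟩
  obtain ⟨κ, hκ, hxy⟩ := exists_hilbertClose hx hy
  refine ⟨ρ * -Real.log κ, fun n => ?_⟩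
  have key : HilbertClose (κ ^ ((1 - δ) ^ n)) ((fun x => rescale ρ (T x))^[n] x)
      ((fun x => rescale ρ (T x))^[n] y) := by
    induction n with
    | zero => simpa using hxy
    | succ n ih =>
      rw [Function.iterate_succ_apply', Function.iterate_succ_apply', pow_succ,
        Real.rpow_mul hκ.le]
      exact hT.hilbertClose_rescale hδ hδ1 hδT (hT.isNormalized_iterate hx n)
        (hT.isNormalized_iterate hy n) (Real.rpow_pos_of_pos hκ _) ih
  refine (key.dist_le (hT.isNormalized_iterate hx n) (hT.isNormalized_iterate hy n)
    (Real.rpow_pos_of_pos hκ _)).trans_eq ?_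
  rw [Real.log_rpow hκ]
  ring

/-- Finite concave functions are continuous on open convex sets, here the open orthant. -/
lemma continuousAt_rescale (hT : IsConcaveInterference T) (hx : ∀ k, 0 < x k) :
    ContinuousAt (fun x => rescale ρ (T x)) x := by
  have hopen : IsOpen (Set.univ.pi fun _ : Fin K => Set.Ioi (0 : ℝ)) :=
    isOpen_set_pi Set.finite_univ fun _ _ => isOpen_Ioi
  have hcT : ContinuousAt T x := by
    refine continuousAt_pi.2 fun k => ?_
    have hsub : (Set.univ.pi fun _ : Fin K => Set.Ioi (0 : ℝ)) ⊆ Set.Ici 0 :=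
      fun z hz k => (hz k trivial).le
    have hconv : Convex ℝ (Set.univ.pi fun _ : Fin K => Set.Ioi (0 : ℝ)) :=
      convex_pi fun _ _ => convex_Ioi 0
    exact (((hT.concave k).subset hsub hconv).continuousOn hopen).continuousAt
      (hopen.mem_nhds fun k _ => hx k)
  have hM : ContinuousAt (fun x => maxUE (T x)) x :=
    ContinuousAt.comp (g := maxUE) continuous_maxUE.continuousAt hcT
  refine continuousAt_pi.2 fun k => ?_
  exact (continuousAt_const.div hM (hT.maxUE_pos fun k => (hx k).le).ne').mul
    ((continuous_apply k).continuousAt.comp hcT)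

/-- The normalized iteration has a fixed point that attracts all normalized vectors. -/
lemma exists_fixedPoint (hT : IsConcaveInterference T) (hρ : 0 < ρ) :
    ∃ z, IsNormalized ρ z ∧ rescale ρ (T z) = z ∧ ∀ x, IsNormalized ρ x →
      Tendsto (fun n => (fun x => rescale ρ (T x))^[n] x) atTop (𝓝 z) := by
  set f : (Fin K → ℝ) → Fin K → ℝ := fun x => rescale ρ (T x) with hf
  obtain ⟨r, hr0, hr1, hr⟩ := hT.exists_geometric_rate hρ
  have h0 : (0 : Fin K → ℝ) ≤ fun _ => ρ := fun _ => hρ.le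
  set w := f fun _ => ρ with hw
  have hwN : IsNormalized ρ w := hT.isNormalized_rescale hρ h0
  have hN := fun n => hT.isNormalized_iterate hwN n
  -- Comparing the orbits of `w` and `f w` bounds consecutive iterates geometrically, so the orbit
  -- is Cauchy.
  obtain ⟨A, hA⟩ := hr w (f w) hwN (hT.isNormalized_rescale hρ fun k => (hwN.1 k).le)
  obtain ⟨z, hz⟩ := cauchySeq_tendsto_of_complete
    (cauchySeq_of_le_geometric (f := fun n => f^[n] w) r A hr1 fun n => by
      simpa only [Function.iterate_succ_apply] using hA n)
  -- A lower bound uniform in `n` keeps the limit off the boundary of the orthant, where continuity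
  -- of `T` is not available.
  have hlower : ∀ n k, ρ / maxUE (T fun _ => ρ) * T 0 k ≤ f^[n + 1] w k := by
    intro n k
    have hn0 : 0 ≤ f^[n] w := fun k => ((hN n).1 k).le
    obtain ⟨m, hm⟩ := exists_eq_maxUE (T (f^[n] w))
    have hle : maxUE (T (f^[n] w)) ≤ maxUE (T fun _ => ρ) := by
      rw [hm]
      exact (hT.mono _ _ hn0 (fun k => (hN n).le k) m).trans (le_maxUE _ m)
    have := hT.maxUE_pos hn0
    have := (hT.pos k).le
    rw [Function.iterate_succ_apply']
    exact mul_le_mul (by gcongr) (hT.mono _ _ le_rfl hn0 k) this (by positivity)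
  have hz' : Tendsto (fun n => f^[n + 1] w) atTop (𝓝 z) := hz.comp (tendsto_add_atTop_nat 1)
  have hzpos : ∀ k, 0 < z k := fun k =>
    (mul_pos (div_pos hρ (hT.maxUE_pos h0)) (hT.pos k)).trans_le
      (ge_of_tendsto ((continuous_apply k).continuousAt.tendsto.comp hz')
        (Eventually.of_forall fun n => hlower n k))
  have hzmax : maxUE z = ρ := by
    refine tendsto_nhds_unique (continuous_maxUE.continuousAt.tendsto.comp hz) ?_
    exact tendsto_const_nhds.congr fun n => (hN n).2.symm
  have hfix : f z = z := by
    refine tendsto_nhds_unique ?_ hz'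
    simp only [Function.iterate_succ_apply']
    exact (hT.continuousAt_rescale hzpos).tendsto.comp hz
  refine ⟨z, ⟨hzpos, hzmax⟩, hfix, fun x hx => ?_⟩
  obtain ⟨B, hB⟩ := hr x z hx ⟨hzpos, hzmax⟩
  rw [tendsto_iff_dist_tendsto_zero]
  refine squeeze_zero (fun _ => dist_nonneg) (fun n => ?_)
    (by simpa using (tendsto_pow_atTop_nhds_zero_of_lt_one hr0 hr1).const_mul B)
  have := hB n
  rwa [Function.iterate_fixed hfix] at this

/-- A fixed point of the normalized iteration maximizes the smallest ratio `x k / T x k`. -/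
lemma minUE_div_le_of_fixedPoint (hT : IsConcaveInterference T) {z : Fin K → ℝ}
    (hz : IsNormalized ρ z) (hfix : rescale ρ (T z) = z) (hx : x ∈ feasible K ρ) :
    minUE (fun k => x k / T x k) ≤ minUE fun k => z k / T z k := by
  have hρ : 0 < ρ := (hz.1 0).trans_le (hz.le 0)
  have hz0 : 0 ≤ z := fun k => (hz.1 k).le
  have hx0 : 0 ≤ x := fun k => (hx k).1
  have hM := hT.maxUE_pos hz0
  have hval : ∀ k, z k / T z k = ρ / maxUE (T z) := by
    intro k
    rw [div_eq_iff (hT.apply_pos hz0 k).ne']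
    exact (congrFun hfix k).symm
  obtain ⟨m, hm⟩ := exists_eq_minUE fun k => z k / T z k
  rw [hm]
  simp only [hval]
  obtain ⟨j, hj⟩ := exists_eq_minUE fun k => x k / z k
  have hmin : ∀ k, x j / z j * z k ≤ x k := fun k => by
    rw [← le_div_iff₀ (hz.1 k), ← hj]
    exact minUE_le _ k
  have hμ0 : 0 ≤ x j / z j := div_nonneg (hx j).1 (hz.1 j).le
  -- At the coordinate where `z` reaches `ρ`, feasibility gives `x ≤ z`.
  have hμ1 : x j / z j ≤ 1 := by
    obtain ⟨i, hi⟩ := exists_eq_maxUE z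
    rw [← hj]
    refine (minUE_le _ i).trans ((div_le_one (hz.1 i)).2 ?_)
    rw [← hi, hz.2]
    exact (hx i).2
  refine (minUE_le _ j).trans ?_
  rw [div_le_iff₀ (hT.apply_pos hx0 j)]
  have h1 : x j / z j * T z j ≤ T x j := by
    have h2 := hT.le_smul hz0 hμ0 hμ1 j
    have h3 := hT.mono _ _ (smul_nonneg hμ0 hz0) hmin j
    have h4 := mul_nonneg (sub_nonneg.2 hμ1) (hT.pos j).le
    linarith
  calc x j = ρ / maxUE (T z) * (x j / z j * T z j) := by
        rw [← hval j]
        have := hT.apply_pos hz0 j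
        have := hz.1 j
        field_simp
    _ ≤ ρ / maxUE (T z) * T x j := by gcongr

end IsConcaveInterference

end CellFree

/-! ### Two inequalities -/

open scoped ComplexOrder in
/-- The Cauchy–Schwarz inequality `|a^H b|² ≤ (a^H C a) (b^H C⁻¹ b)`. -/
lemma Matrix.PosDef.norm_dotProduct_sq_le {n : Type*} [Fintype n] [DecidableEq n]
    {C : Matrix n n ℂ} (hC : C.PosDef) (a b : n → ℂ) :
    ‖star a ⬝ᵥ b‖ ^ 2 ≤ (star a ⬝ᵥ (C *ᵥ a)).re * (star b ⬝ᵥ (C⁻¹ *ᵥ b)).re := by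
  by_cases hb : b = 0
  · simp [hb]
  set y := C⁻¹ *ᵥ b with hy
  have hCy : C *ᵥ y = b := by
    rw [hy, Matrix.mulVec_mulVec,
      Matrix.mul_nonsing_inv _ ((Matrix.isUnit_iff_isUnit_det _).1 hC.isUnit),
      Matrix.one_mulVec]
  have hG := hC.inv.dotProduct_mulVec_pos hb
  rw [← hy] at hG
  obtain ⟨hGre, hGim⟩ := Complex.pos_iff.1 hG
  set G := (star b ⬝ᵥ y).re with hGdef
  have hGeq : star b ⬝ᵥ y = (G : ℂ) := Complex.ext rfl (by simpa using hGim.symm)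
  have hyb : star y ⬝ᵥ b = (G : ℂ) := by
    rw [← Complex.conj_ofReal, ← hGeq, starRingEnd_apply, Matrix.star_dotProduct]
  set c := star a ⬝ᵥ b with hc
  have hyCa : star y ⬝ᵥ (C *ᵥ a) = star c := by
    have h := Matrix.star_mulVec C y
    rw [hC.isHermitian.eq, hCy] at h
    rw [Matrix.dotProduct_mulVec, ← h, hc, ← Matrix.star_dotProduct_star, star_star]
  -- Nonnegativity of the form at the `C`-orthogonal residual of `a` against `y`, multiplied by `G`
  -- to avoid division.
  have h0 := (Complex.nonneg_iff.1
    (hC.posSemidef.dotProduct_mulVec_nonneg ((G : ℂ) • a - star c • y))).1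
  have hexp : star ((G : ℂ) • a - star c • y) ⬝ᵥ (C *ᵥ ((G : ℂ) • a - star c • y)) =
      (G : ℂ) * (G * (star a ⬝ᵥ (C *ᵥ a)) - c * star c) := by
    simp only [Matrix.mulVec_sub, Matrix.mulVec_smul, star_sub, star_smul, sub_dotProduct,
      dotProduct_sub, smul_dotProduct, dotProduct_smul, hCy, hyCa, hyb, smul_eq_mul, star_star,
      ← hc]
    simp only [Complex.star_def, Complex.conj_ofReal]
    ring
  rw [hexp, Complex.re_ofReal_mul, Complex.sub_re, Complex.re_ofReal_mul, Complex.star_def,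
    Complex.mul_conj, Complex.ofReal_re, Complex.normSq_eq_norm_sq] at h0
  have := nonneg_of_mul_nonneg_right h0 hGre
  linarith

lemma MeasureTheory.norm_integral_sq_le {Ω : Type*} [MeasurableSpace Ω] {P : Measure Ω}
    [IsProbabilityMeasure P] {X : Ω → ℂ} (hX : MemLp X 2 P) :
    ‖∫ ω, X ω ∂P‖ ^ 2 ≤ ∫ ω, ‖X ω‖ ^ 2 ∂P := by
  have h1 := ProbabilityTheory.variance_nonneg (fun ω => ‖X ω‖) P
  rw [ProbabilityTheory.variance_eq_sub hX.norm] at h1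
  have h2 : ‖∫ ω, X ω ∂P‖ ^ 2 ≤ (∫ ω, ‖X ω‖ ∂P) ^ 2 := by
    gcongr
    exact norm_integral_le_integral_norm _
  simp only [Pi.pow_apply] at h1
  linarith

/-! ### The quadratic form of `C` -/

namespace CellFree

variable {K L N : ℕ} {Ω : Type*} [MeasurableSpace Ω] {S : CellFree K L N Ω} {P : Measure Ω}

lemma memLp_dotProduct_g (hg : ∀ k i, ∀ l : S.M k, MemLp (fun ω => S.g k i ω l) 2 P)
    (k i : Fin K) (a : S.M k → ℂ) : MemLp (fun ω => star a ⬝ᵥ S.g k i ω) 2 P := by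
  simp only [dotProduct]
  exact memLp_finsetSum _ fun l _ => (hg k i l).const_mul _

lemma integrable_g_mul (hg : ∀ k i, ∀ l : S.M k, MemLp (fun ω => S.g k i ω l) 2 P)
    (k i : Fin K) (l m : S.M k) : Integrable (fun ω => S.g k i ω l * star (S.g k i ω m)) P :=
  (hg k i l).integrable_mul (hg k i m).star

lemma star_dotProduct_corrG (hg : ∀ k i, ∀ l : S.M k, MemLp (fun ω => S.g k i ω l) 2 P)
    (k i : Fin K) (a : S.M k → ℂ) :
    star a ⬝ᵥ (S.corrG P k i *ᵥ a) = ((∫ ω, ‖star a ⬝ᵥ S.g k i ω‖ ^ 2 ∂P : ℝ) : ℂ) := by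
  have hpt : ∀ ω, ((‖star a ⬝ᵥ S.g k i ω‖ ^ 2 : ℝ) : ℂ) =
      ∑ l, ∑ m, star (a l) * a m * (S.g k i ω l * star (S.g k i ω m)) := by
    intro ω
    rw [← Complex.normSq_eq_norm_sq, ← Complex.mul_conj, dotProduct, map_sum,
      Finset.sum_mul_sum]
    refine Finset.sum_congr rfl fun l _ => Finset.sum_congr rfl fun m _ => ?_
    simp only [Pi.star_apply, map_mul, Complex.star_def, Complex.conj_conj]
    ring
  rw [← integral_complex_ofReal]
  simp only [hpt]
  rw [integral_finsetSum _ fun l _ => integrable_finsetSum _ fun m _ =>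
    (integrable_g_mul hg k i l m).const_mul _]
  simp only [dotProduct, Matrix.mulVec, Finset.mul_sum]
  refine Finset.sum_congr rfl fun l _ => ?_
  rw [integral_finsetSum _ fun m _ => (integrable_g_mul hg k i l m).const_mul _]
  refine Finset.sum_congr rfl fun m _ => ?_
  rw [integral_const_mul, corrG, Matrix.of_apply, Pi.star_apply]
  ring

lemma isHermitian_C (η : Fin K → ℝ) (k : Fin K) : (S.C P η k).IsHermitian := by
  have hcorr : ∀ i, (S.corrG P k i).IsHermitian := by
    intro i
    ext l m
    simp only [Matrix.conjTranspose_apply, corrG, Matrix.of_apply, Complex.star_def]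
    rw [← integral_conj]
    refine integral_congr_ae (Eventually.of_forall fun ω => ?_)
    simp only [map_mul, Complex.conj_conj]
    ring
  have hreal : ∀ (c : ℝ) {M : Matrix (S.M k) (S.M k) ℂ}, M.IsHermitian →
      ((c : ℂ) • M).IsHermitian := by
    intro c M hM
    rw [Matrix.IsHermitian, Matrix.conjTranspose_smul, hM.eq, Complex.star_def,
      Complex.conj_ofReal]
  have hvec : (Matrix.vecMulVec (S.meanG P k) (star (S.meanG P k))).IsHermitian := by
    rw [Matrix.IsHermitian, Matrix.conjTranspose_vecMulVec, star_star]
  have hnoise : (S.noiseMat P k).IsHermitian := by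
    refine Matrix.isHermitian_diagonal_of_self_adjoint _ ?_
    ext l
    simp [Complex.conj_ofReal]
  refine Matrix.IsHermitian.add (Matrix.IsHermitian.sub ?_ (hreal _ hvec)) hnoise
  rw [Matrix.IsHermitian, Matrix.conjTranspose_sum]
  exact Finset.sum_congr rfl fun i _ => (hreal _ (hcorr i)).eq

/-- The power that interferer `i` contributes after combining with weights `a`; for `i = k` this
is the variance of the effective channel. -/
noncomputable def interf (S : CellFree K L N Ω) (P : Measure Ω) (k : Fin K) (a : S.M k → ℂ)
    (i : Fin K) : ℝ :=
  (∫ ω, ‖star a ⬝ᵥ S.g k i ω‖ ^ 2 ∂P) - if i = k then ‖star a ⬝ᵥ S.meanG P k‖ ^ 2 else 0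

/-- The noise power after combining with weights `a`. -/
noncomputable def noisePower (S : CellFree K L N Ω) (P : Measure Ω) (k : Fin K)
    (a : S.M k → ℂ) : ℝ :=
  ∑ l, ‖a l‖ ^ 2 * (S.σ ^ 2 * ∫ ω, ‖S.v k l ω‖ ^ 2 ∂P)

lemma star_dotProduct_C (hg : ∀ k i, ∀ l : S.M k, MemLp (fun ω => S.g k i ω l) 2 P)
    (η : Fin K → ℝ) (k : Fin K) (a : S.M k → ℂ) :
    star a ⬝ᵥ (S.C P η k *ᵥ a) =
      ((∑ i, η i * S.interf P k a i + S.noisePower P k a : ℝ) : ℂ) := by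
  have hmean : star a ⬝ᵥ (Matrix.vecMulVec (S.meanG P k) (star (S.meanG P k)) *ᵥ a) =
      ((‖star a ⬝ᵥ S.meanG P k‖ ^ 2 : ℝ) : ℂ) := by
    rw [Matrix.vecMulVec_mulVec, ← Complex.normSq_eq_norm_sq, ← Complex.mul_conj,
      ← Complex.star_def, ← Matrix.star_dotProduct_star, star_star]
    simp [dotProduct_smul, dotProduct_comm, mul_comm]
  have hnoise : star a ⬝ᵥ (S.noiseMat P k *ᵥ a) = ((S.noisePower P k a : ℝ) : ℂ) := by
    simp only [noisePower, noiseMat, dotProduct, Matrix.mulVec_diagonal, Complex.ofReal_sum]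
    refine Finset.sum_congr rfl fun l _ => ?_
    rw [Complex.ofReal_mul (‖a l‖ ^ 2), ← Complex.normSq_eq_norm_sq, ← Complex.mul_conj,
      Pi.star_apply, Complex.star_def]
    ring
  simp only [C, Matrix.add_mulVec, Matrix.sub_mulVec, Matrix.sum_mulVec, Matrix.smul_mulVec,
    dotProduct_add, dotProduct_sub, dotProduct_sum, dotProduct_smul, hmean, hnoise,
    star_dotProduct_corrG hg, smul_eq_mul, interf, mul_sub, Finset.sum_sub_distrib, mul_ite,
    mul_zero, Finset.sum_ite_eq', Finset.mem_univ, if_true]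
  push_cast
  ring

/-- For `i = k` this is a second moment minus a squared mean, hence nonnegative. -/
lemma interf_nonneg [IsProbabilityMeasure P]
    (hg : ∀ k i, ∀ l : S.M k, MemLp (fun ω => S.g k i ω l) 2 P)
    (k : Fin K) (a : S.M k → ℂ) (i : Fin K) : 0 ≤ S.interf P k a i := by
  unfold interf
  split_ifs with h
  · subst h
    have hmean : star a ⬝ᵥ S.meanG P i = ∫ ω, star a ⬝ᵥ S.g i i ω ∂P := by
      simp only [dotProduct, meanG]
      rw [integral_finsetSum _ fun l _ =>
        ((hg i i l).integrable one_le_two).const_mul _]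
      simp only [integral_const_mul]
    rw [hmean]
    exact sub_nonneg.2 (norm_integral_sq_le (memLp_dotProduct_g hg i i a))
  · rw [sub_zero]
    exact integral_nonneg fun ω => by positivity

lemma noisePower_pos (hσ : 0 < S.σ) (hv : ∀ k, ∀ l ∈ S.M k, MemLp (S.v k l) 2 P)
    (hv0 : ∀ k, ∀ l ∈ S.M k, ¬ S.v k l =ᵐ[P] 0) (k : Fin K) {a : S.M k → ℂ} (ha : a ≠ 0) :
    0 < S.noisePower P k a := by
  have hE : ∀ l : S.M k, 0 < ∫ ω, ‖S.v k l ω‖ ^ 2 ∂P := by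
    intro l
    refine (integral_nonneg fun ω => by positivity).lt_of_ne fun h => hv0 k l l.2 ?_
    have h0 := (integral_eq_zero_iff_of_nonneg (fun ω => by positivity)
      ((hv k l l.2).integrable_norm_pow two_ne_zero)).1 h.symm
    filter_upwards [h0] with ω hω
    simpa using hω
  obtain ⟨l, hl⟩ := Function.ne_iff.1 ha
  refine Finset.sum_pos' (fun m _ => ?_) ⟨l, Finset.mem_univ l, ?_⟩
  · have := hE m
    positivity
  · have := hE l
    have := norm_pos_iff.2 hl
    positivity

/-- The standing assumptions on the network: finite second moments, nonzero combiners and nonzero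
mean effective channels. -/
structure Regular (S : CellFree K L N Ω) (P : Measure Ω) : Prop where
  noise : 0 < S.σ
  memLp_v : ∀ k, ∀ l ∈ S.M k, MemLp (S.v k l) 2 P
  memLp_g : ∀ k i, ∀ l : S.M k, MemLp (fun ω => S.g k i ω l) 2 P
  v_ne : ∀ k, ∀ l ∈ S.M k, ¬ S.v k l =ᵐ[P] 0
  meanG_ne : ∀ k, S.meanG P k ≠ 0

/-! ### Optimal combining and the update as a minimum of affine maps -/

namespace Regular

variable [IsProbabilityMeasure P] {η : Fin K → ℝ}

open scoped ComplexOrder in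
lemma posDef_C (hS : S.Regular P) (hη : 0 ≤ η) (k : Fin K) : (S.C P η k).PosDef := by
  refine Matrix.PosDef.of_dotProduct_mulVec_pos (isHermitian_C η k) fun a ha => ?_
  rw [star_dotProduct_C hS.memLp_g, ← Complex.ofReal_zero, Complex.real_lt_real]
  exact add_pos_of_nonneg_of_pos
    (Finset.sum_nonneg fun i _ => mul_nonneg (hη i) (interf_nonneg hS.memLp_g k a i))
    (noisePower_pos hS.noise hS.memLp_v hS.v_ne k ha)

open scoped ComplexOrder in
lemma gain_pos (hS : S.Regular P) (hη : 0 ≤ η) (k : Fin K) : 0 < S.gain P η k :=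
  (Complex.pos_iff.1 ((hS.posDef_C hη k).inv.dotProduct_mulVec_pos (hS.meanG_ne k))).1

lemma norm_sq_le (hS : S.Regular P) (hη : 0 ≤ η) (k : Fin K) (a : S.M k → ℂ) :
    ‖star a ⬝ᵥ S.meanG P k‖ ^ 2 ≤ (star a ⬝ᵥ (S.C P η k *ᵥ a)).re * S.gain P η k :=
  (hS.posDef_C hη k).norm_dotProduct_sq_le a _

open scoped ComplexOrder in
lemma star_optLSFD_dotProduct_meanG (hS : S.Regular P) (hη : 0 ≤ η) (k : Fin K) :
    star (S.optLSFD P η k) ⬝ᵥ S.meanG P k = (S.gain P η k : ℂ) := by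
  have hh : star (S.optLSFD P η k) ⬝ᵥ S.meanG P k =
      star (S.meanG P k) ⬝ᵥ ((S.C P η k)⁻¹ *ᵥ S.meanG P k) := by
    rw [optLSFD, Matrix.star_mulVec, (hS.posDef_C hη k).inv.isHermitian.eq,
      Matrix.dotProduct_mulVec]
  have him : (star (S.meanG P k) ⬝ᵥ ((S.C P η k)⁻¹ *ᵥ S.meanG P k)).im = 0 :=
    (hS.posDef_C hη k).inv.isHermitian.im_star_dotProduct_mulVec_self _
  rw [hh]
  exact Complex.ext rfl (by simpa using him)

open scoped ComplexOrder in
lemma C_mulVec_optLSFD (hS : S.Regular P) (hη : 0 ≤ η) (k : Fin K) :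
    S.C P η k *ᵥ S.optLSFD P η k = S.meanG P k := by
  rw [optLSFD, Matrix.mulVec_mulVec, Matrix.mul_nonsing_inv _
    ((Matrix.isUnit_iff_isUnit_det _).1 (hS.posDef_C hη k).isUnit), Matrix.one_mulVec]

lemma sinr_optLSFD (hS : S.Regular P) (hη : 0 ≤ η) (k : Fin K) :
    S.sinr P η k (S.optLSFD P η k) = S.sinrOpt P η k := by
  have := hS.gain_pos hη k
  rw [sinr, hS.C_mulVec_optLSFD hη, hS.star_optLSFD_dotProduct_meanG hη, Complex.ofReal_re,
    Complex.norm_real, Real.norm_of_nonneg this.le, sinrOpt]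
  field_simp

lemma sinr_le_sinrOpt (hS : S.Regular P) (hη : 0 ≤ η) (k : Fin K) (a : S.M k → ℂ) :
    S.sinr P η k a ≤ S.sinrOpt P η k := by
  have hg0 := hS.gain_pos hη k
  have hle := hS.norm_sq_le hη k a
  have hq : 0 ≤ (star a ⬝ᵥ (S.C P η k *ᵥ a)).re := by
    by_contra! h
    nlinarith [sq_nonneg ‖star a ⬝ᵥ S.meanG P k‖]
  -- Only a nonnegative denominator is required, so `a = 0`, where the quotient is `0`, is covered.
  refine div_le_of_le_mul₀ hq (mul_nonneg (hη k) hg0.le) ?_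
  rw [sinrOpt, mul_assoc, mul_comm (S.gain P η k)]
  exact mul_le_mul_of_nonneg_left hle (hη k)

lemma update_le (hS : S.Regular P) (hη : 0 ≤ η) (k : Fin K) {a : S.M k → ℂ}
    (ha : star a ⬝ᵥ S.meanG P k = 1) :
    S.update P η k ≤ ∑ i, η i * S.interf P k a i + S.noisePower P k a := by
  have hle := hS.norm_sq_le hη k a
  rw [ha, star_dotProduct_C hS.memLp_g, Complex.ofReal_re, norm_one, one_pow] at hle
  rwa [update, div_le_iff₀ (hS.gain_pos hη k)]

/-- The bound of `update_le` is attained by the optimal LSFD vector scaled to unit response. -/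
lemma exists_update_eq (hS : S.Regular P) (hη : 0 ≤ η) (k : Fin K) :
    ∃ a : S.M k → ℂ, star a ⬝ᵥ S.meanG P k = 1 ∧
      S.update P η k = ∑ i, η i * S.interf P k a i + S.noisePower P k a := by
  have hG := hS.gain_pos hη k
  have hG' : (S.gain P η k : ℂ) ≠ 0 := Complex.ofReal_ne_zero.2 hG.ne'
  have hone : star ((S.gain P η k : ℂ)⁻¹ • S.optLSFD P η k) ⬝ᵥ S.meanG P k = 1 := by
    rw [star_smul, smul_dotProduct, hS.star_optLSFD_dotProduct_meanG hη, star_inv₀,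
      Complex.star_def, Complex.conj_ofReal, smul_eq_mul, inv_mul_cancel₀ hG']
  refine ⟨_, hone, ?_⟩
  have h := star_dotProduct_C hS.memLp_g η k ((S.gain P η k : ℂ)⁻¹ • S.optLSFD P η k)
  rw [Matrix.mulVec_smul, hS.C_mulVec_optLSFD hη, dotProduct_smul, hone, smul_eq_mul, mul_one] at h
  rw [update, one_div]
  exact Complex.ofReal_injective ((Complex.ofReal_inv _).trans h)

lemma isConcaveInterference_update (hS : S.Regular P) :
    IsConcaveInterference (S.update P) where
  mono x y hx hxy k := by
    obtain ⟨a, ha, hy⟩ := hS.exists_update_eq (hx.trans hxy) k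
    rw [hy]
    refine (hS.update_le hx k ha).trans ?_
    gcongr with i
    · exact interf_nonneg hS.memLp_g k a i
    · exact hxy i
  concave k := by
    refine ⟨convex_Ici 0, fun x hx y hy s t hs ht hst => ?_⟩
    have hxy : 0 ≤ s • x + t • y := add_nonneg (smul_nonneg hs hx) (smul_nonneg ht hy)
    -- The minimizer at the convex combination is admissible, though perhaps suboptimal, at both
    -- endpoints.
    obtain ⟨a, ha, h⟩ := hS.exists_update_eq hxy k
    have h1 := mul_le_mul_of_nonneg_left (hS.update_le hx k ha) hs
    have h2 := mul_le_mul_of_nonneg_left (hS.update_le hy k ha) ht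
    simp only [smul_eq_mul]
    rw [h]
    refine (add_le_add h1 h2).trans_eq ?_
    simp only [mul_add, Finset.mul_sum, Pi.add_apply, Pi.smul_apply, smul_eq_mul, add_mul,
      Finset.sum_add_distrib, mul_assoc]
    linear_combination S.noisePower P k a * hst
  pos k := one_div_pos.2 (hS.gain_pos le_rfl k)

end Regular

lemma iterate_succ_eq [NeZero K] (ρ : ℝ) (η₀ : Fin K → ℝ) (j : ℕ) :
    S.iterate P ρ η₀ (j + 1) =
      (fun η => rescale ρ (S.update P η))^[j] (rescale ρ (S.update P η₀)) := by
  induction j with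
  | zero => rfl
  | succ j ih =>
    rw [Function.iterate_succ_apply', ← ih]
    rfl

end CellFree

theorem lemma2 {K L N : ℕ} [NeZero K] {Ω : Type*} [MeasurableSpace Ω]
    (P : Measure Ω) [IsProbabilityMeasure P] (S : CellFree K L N Ω) (ρ : ℝ)
    (hσ : 0 < S.σ) (hρ : 0 < ρ)
    (hv : ∀ k, ∀ l ∈ S.M k, MemLp (S.v k l) 2 P)
    (hg : ∀ k i, ∀ l : S.M k, MemLp (fun ω => S.g k i ω l) 2 P)
    (hv0 : ∀ k, ∀ l ∈ S.M k, ¬ S.v k l =ᵐ[P] 0)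
    (hg0 : ∀ k, S.meanG P k ≠ 0) :
    ∃ ηs : Fin K → ℝ,
      ηs ∈ CellFree.feasible K ρ ∧
      IsMaxOn (fun η => CellFree.minUE (S.sinrOpt P η)) (CellFree.feasible K ρ) ηs ∧
      (∀ η ∈ CellFree.feasible K ρ, ∀ a : (k : Fin K) → S.M k → ℂ,
        CellFree.minUE (fun k => S.sinr P η k (a k)) ≤
          CellFree.minUE (fun k => S.sinr P ηs k (S.optLSFD P ηs k))) ∧
      ∀ η₀ : Fin K → ℝ, (∀ k, 0 < η₀ k) →
        Tendsto (S.iterate P ρ η₀) atTop (𝓝 ηs) := by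
  have hS : S.Regular P := ⟨hσ, hv, hg, hv0, hg0⟩
  have hT := hS.isConcaveInterference_update
  obtain ⟨z, hz, hfix, hconv⟩ := hT.exists_fixedPoint hρ
  have hz0 : 0 ≤ z := fun k => (hz.1 k).le
  have hratio : ∀ η, S.sinrOpt P η = fun k => η k / S.update P η k := by
    intro η
    ext k
    rw [CellFree.sinrOpt, CellFree.update, div_div_eq_mul_div, div_one]
  have hmax : ∀ η ∈ CellFree.feasible K ρ,
      CellFree.minUE (S.sinrOpt P η) ≤ CellFree.minUE (S.sinrOpt P z) := by
    intro η hη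
    rw [hratio, hratio]
    exact hT.minUE_div_le_of_fixedPoint hz hfix hη
  refine ⟨z, fun k => ⟨hz0 k, hz.le k⟩, hmax, fun η hη a => ?_, fun η₀ hη₀ => ?_⟩
  · simp only [hS.sinr_optLSFD hz0]
    exact (CellFree.minUE_mono fun k => hS.sinr_le_sinrOpt (fun k => (hη k).1) k (a k)).trans
      (hmax η hη)
  -- The initial powers need not be normalized; after one step they are.
  · rw [← tendsto_add_atTop_iff_nat 1]
    simp only [CellFree.iterate_succ_eq]
    exact hconv _ (hT.isNormalized_rescale hρ fun k => (hη₀ k).le)
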